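/- Let $G$ be a second countable locally compact Hausdorff group with a right Haar measure $\lambda$, and let $\Phi:\mathbb R\to\mathbb R$ be a Young function, i.e. a continuous, even, convex function with $\Phi(0)=0$, $\Phi(t)>0$ for $t>0$ and $\lim_{t\to\infty}\Phi(t)=\infty$. Assume that $\Phi$ is $\Delta_2$-regular: there is $M>0$ such that $\Phi(2t)\le M\Phi(t)$ for all $t>0$ if $G$ is noncompact, and for all $t\ge t_0$, for some $t_0>0$, if $G$ is compact. Let $L^\Phi(G)$ be the Orlicz space of (classes modulo $\lambda$-a.e. equality of) Borel functions $f:G\to\mathbb C$ with $\int_G\Phi(\alpha|f|)\,d\lambda<\infty$ for some $\alpha>0$, with the Luxemburg norm $N_\Phi(f)=\inf\{k>0:\int_G\Phi(|f|/k)\,d\lambda\le 1\}$. Let $a\in G$ be aperiodic, i.e. the closed subgroup of $G$ generated by $a$ is not compact. Let $w:G\to(0,\infty)$ be continuous with $w$ and $w^{-1}$ bounded, and let $T_{a,w}:L^\Phi(G)\to L^\Phi(G)$ be the weighted translation $(T_{a,w}f)(x)=w(x)f(xa^{-1})$. Call a continuous linear operator $T$ on a normed space $X$ *topologically transitive* if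 for all nonempty open $U,V\subset X$ there is $n\ge1$ with $T^nU\cap V\ne\emptyset$; *topologically mixing* if for all nonempty open $U,V\subset X$ there is $N$ with $T^nU\cap V\neq\emptyset$ for all $n\ge N$; *chaotic* if it is topologically transitive and the set of its periodic points ($T^nx=x$ for some $n\ge1$) is dense in $X$; *topologically multiply recurrent* if for every integer $L\ge1$ and every nonempty open $U\subset X$ there is $n\ge1$ with $U\cap T^{-n}U\cap T^{-2n}U\cap\cdots\cap T^{-Ln}U\neq\emptyset$. If $T_{a,w}$ is chaotic or topologically mixing on $L^\Phi(G)$, then $T_{a,w}$ is topologically multiply recurrent. -/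

import Mathlib

open MeasureTheory Set
open scoped ENNReal

/-! ## Young functions -/

/-- A Young function: a continuous, even, convex function `Φ : ℝ → ℝ` with `Φ 0 = 0`,
`Φ t > 0` for `t > 0` and `Φ t → ∞` as `t → ∞`. -/
structure YoungFunction where
  toFun : ℝ → ℝ
  continuous_toFun : Continuous toFun
  even_toFun : ∀ t, toFun (-t) = toFun t
  convexOn_toFun : ConvexOn ℝ univ toFun
  map_zero_toFun : toFun 0 = 0
  pos_toFun : ∀ t, 0 < t → 0 < toFun t
  tendsto_toFun : Filter.Tendsto toFun Filter.atTop Filter.atTop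

namespace YoungFunction

instance instCoeFun : CoeFun YoungFunction (fun _ => ℝ → ℝ) := ⟨YoungFunction.toFun⟩

/-- `Φ` is `Δ₂`-regular (relative to the space `G`): `Φ (2t) ≤ M Φ t` for all large `t` when `G` is
compact, and for all `t > 0` when `G` is not compact. -/
def IsDelta2Regular (Φ : YoungFunction) (G : Type*) [TopologicalSpace G] : Prop :=
  (CompactSpace G → ∃ M > 0, ∃ t₀ > 0, ∀ t, t₀ ≤ t → Φ (2 * t) ≤ M * Φ t) ∧
  (¬ CompactSpace G → ∃ M > 0, ∀ t, 0 < t → Φ (2 * t) ≤ M * Φ t)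

theorem nonneg (Φ : YoungFunction) {t : ℝ} (ht : 0 ≤ t) : 0 ≤ Φ t := by
  rcases ht.eq_or_lt with rfl | h
  · exact Φ.map_zero_toFun.ge
  · exact (Φ.pos_toFun t h).le

theorem map_mul_le (Φ : YoungFunction) {c : ℝ} (t : ℝ) (hc : 0 ≤ c) (hc1 : c ≤ 1) :
    Φ (c * t) ≤ c * Φ t := by
  have h := Φ.convexOn_toFun.2 (mem_univ t) (mem_univ 0) hc (sub_nonneg.2 hc1) (by ring)
  simpa [Φ.map_zero_toFun] using h

theorem mono (Φ : YoungFunction) {s t : ℝ} (hs : 0 ≤ s) (hst : s ≤ t) : Φ s ≤ Φ t := by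
  rcases hs.eq_or_lt with rfl | h
  · rw [Φ.map_zero_toFun]; exact Φ.nonneg hst
  · have ht : 0 < t := h.trans_le hst
    have h1 : s / t ≤ 1 := (div_le_one ht).2 hst
    have h2 := Φ.map_mul_le t (div_nonneg hs ht.le) h1
    rw [div_mul_cancel₀ _ ht.ne'] at h2
    exact h2.trans (mul_le_of_le_one_left (Φ.nonneg ht.le) h1)

end YoungFunction

/-! ## Orlicz spaces -/

section Orlicz

variable {α : Type*} [MeasurableSpace α]

/-- The modular `∫ Φ(c |f|) dμ ∈ [0, ∞]`. -/
noncomputable def orliczModular (Φ : YoungFunction) (μ : Measure α) (c : ℝ) (f : α → ℂ) : ℝ≥0∞ :=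
  ∫⁻ x, ENNReal.ofReal (Φ (c * ‖f x‖)) ∂μ

/-- The Luxemburg norm `N_Φ(f) = inf {k > 0 : ∫ Φ(|f| / k) dμ ≤ 1}`. -/
noncomputable def luxemburgNorm (Φ : YoungFunction) (μ : Measure α) (f : α → ℂ) : ℝ :=
  sInf {k : ℝ | 0 < k ∧ ∫⁻ x, ENNReal.ofReal (Φ (‖f x‖ / k)) ∂μ ≤ 1}

theorem orliczModular_mono (Φ : YoungFunction) (μ : Measure α) {c d : ℝ} {f g : α → ℂ}
    (hc : 0 ≤ c) (h : ∀ᵐ x ∂μ, c * ‖f x‖ ≤ d * ‖g x‖) :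
    orliczModular Φ μ c f ≤ orliczModular Φ μ d g := by
  refine lintegral_mono_ae (h.mono fun x hx => ?_)
  exact ENNReal.ofReal_le_ofReal (Φ.mono (by positivity) hx)

theorem orliczModular_mul_le (Φ : YoungFunction) (μ : Measure α) {b : ℝ} (c : ℝ) (f : α → ℂ)
    (hb : 0 ≤ b) (hb1 : b ≤ 1) :
    orliczModular Φ μ (b * c) f ≤ ENNReal.ofReal b * orliczModular Φ μ c f := by
  unfold orliczModular
  rw [← lintegral_const_mul' _ _ ENNReal.ofReal_ne_top]
  refine lintegral_mono fun x => ?_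
  rw [← ENNReal.ofReal_mul hb, mul_assoc]
  exact ENNReal.ofReal_le_ofReal (Φ.map_mul_le _ hb hb1)

theorem orliczModular_add_le (Φ : YoungFunction) (μ : Measure α) {a b c d : ℝ}
    {f g h : α → ℂ} (hf : AEStronglyMeasurable f μ)
    (hc : 0 ≤ c) (hd : 0 ≤ d) (ha : 0 ≤ a) (hb : 0 ≤ b) (hab : a + b = 1) {e : ℝ} (he : 0 ≤ e)
    (hle : ∀ᵐ x ∂μ, e * ‖h x‖ ≤ a * (c * ‖f x‖) + b * (d * ‖g x‖)) :
    orliczModular Φ μ e h ≤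
      ENNReal.ofReal a * orliczModular Φ μ c f + ENNReal.ofReal b * orliczModular Φ μ d g := by
  unfold orliczModular
  rw [← lintegral_const_mul' _ _ ENNReal.ofReal_ne_top,
    ← lintegral_const_mul' _ _ ENNReal.ofReal_ne_top, ← lintegral_add_left']
  · refine lintegral_mono_ae (hle.mono fun x hx => ?_)
    rw [← ENNReal.ofReal_mul ha, ← ENNReal.ofReal_mul hb, ← ENNReal.ofReal_add
      (mul_nonneg ha (Φ.nonneg (by positivity))) (mul_nonneg hb (Φ.nonneg (by positivity)))]
    refine ENNReal.ofReal_le_ofReal ((Φ.mono (by positivity) hx).trans ?_)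
    have := Φ.convexOn_toFun.2 (mem_univ (c * ‖f x‖)) (mem_univ (d * ‖g x‖)) ha hb hab
    simpa using this
  · refine AEMeasurable.const_mul ?_ _
    exact ENNReal.measurable_ofReal.comp_aemeasurable
      (Φ.continuous_toFun.measurable.comp_aemeasurable (hf.norm.aemeasurable.const_mul c))

theorem luxemburgNorm_eq (Φ : YoungFunction) (μ : Measure α) (f : α → ℂ) :
    luxemburgNorm Φ μ f = sInf {k : ℝ | 0 < k ∧ orliczModular Φ μ k⁻¹ f ≤ 1} := by
  simp only [luxemburgNorm, orliczModular, div_eq_inv_mul]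

theorem luxemburgNorm_nonneg (Φ : YoungFunction) (μ : Measure α) (f : α → ℂ) :
    0 ≤ luxemburgNorm Φ μ f :=
  Real.sInf_nonneg fun _ hk => hk.1.le

theorem luxemburgNorm_le (Φ : YoungFunction) (μ : Measure α) {f : α → ℂ} {k : ℝ} (hk : 0 < k)
    (h : orliczModular Φ μ k⁻¹ f ≤ 1) : luxemburgNorm Φ μ f ≤ k := by
  rw [luxemburgNorm_eq]
  exact csInf_le ⟨0, fun _ hk => hk.1.le⟩ ⟨hk, h⟩

theorem orliczModular_le_one (Φ : YoungFunction) (μ : Measure α) {f : α → ℂ}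
    (hf : ∃ c > 0, orliczModular Φ μ c f < ∞) {k : ℝ} (hk : luxemburgNorm Φ μ f < k) :
    orliczModular Φ μ k⁻¹ f ≤ 1 := by
  have hne : {k : ℝ | 0 < k ∧ orliczModular Φ μ k⁻¹ f ≤ 1}.Nonempty := by
    obtain ⟨c, hc, hfin⟩ := hf
    set A := (orliczModular Φ μ c f).toReal with hA
    have hA0 : 0 ≤ A := ENNReal.toReal_nonneg
    refine ⟨((A + 1)⁻¹ * c)⁻¹, by positivity, ?_⟩
    rw [inv_inv]
    refine (orliczModular_mul_le Φ μ c f (by positivity)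
      (inv_le_one_of_one_le₀ (by linarith))).trans ?_
    rw [← ENNReal.ofReal_toReal hfin.ne, ← hA, ← ENNReal.ofReal_mul (by positivity)]
    refine ENNReal.ofReal_le_one.2 ?_
    rw [inv_mul_le_iff₀ (by positivity)]
    linarith
  rw [luxemburgNorm_eq] at hk
  obtain ⟨j, ⟨hj, hj1⟩, hjk⟩ := exists_lt_of_csInf_lt hne hk
  refine (orliczModular_mono Φ μ (inv_nonneg.2 (hj.trans hjk).le) (.of_forall fun x => ?_)).trans hj1
  gcongr

theorem luxemburgNorm_eq_zero (Φ : YoungFunction) (μ : Measure α) {f : α → ℂ}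
    (hm : AEStronglyMeasurable f μ) (hf : ∃ c > 0, orliczModular Φ μ c f < ∞)
    (h : luxemburgNorm Φ μ f = 0) : f =ᵐ[μ] 0 := by
  have key : ∀ k : ℝ, 0 < k → k ≤ 1 → orliczModular Φ μ 1 f ≤ ENNReal.ofReal k := by
    intro k hk hk1
    have h1 := orliczModular_mul_le Φ μ k⁻¹ f hk.le hk1
    rw [mul_inv_cancel₀ hk.ne'] at h1
    exact h1.trans (mul_le_of_le_one_right' (orliczModular_le_one Φ μ hf (h ▸ hk)))
  have hz : orliczModular Φ μ 1 f = 0 := by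
    by_contra hne
    obtain ⟨r, hr0, hr⟩ := ENNReal.lt_iff_exists_nnreal_btwn.1 (pos_iff_ne_zero.2 hne)
    have hr0' : 0 < (r : ℝ) := by exact_mod_cast hr0
    have h2 := key (min r 1) (by positivity) (min_le_right _ _)
    refine absurd (h2.trans ?_) (not_le.2 hr)
    exact (ENNReal.ofReal_le_ofReal (min_le_left _ _)).trans (by simp)
  unfold orliczModular at hz
  have hmeas : AEMeasurable (fun x => ENNReal.ofReal (Φ (1 * ‖f x‖))) μ :=
    ENNReal.measurable_ofReal.comp_aemeasurable
      (Φ.continuous_toFun.measurable.comp_aemeasurable (hm.norm.aemeasurable.const_mul 1))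
  rw [lintegral_eq_zero_iff' hmeas] at hz
  filter_upwards [hz] with x hx
  by_contra hne
  have hp := Φ.pos_toFun (1 * ‖f x‖) (by simpa using hne)
  simp only [Pi.zero_apply, ENNReal.ofReal_eq_zero] at hx
  linarith

/-- The Orlicz space `L^Φ(μ)`: (a.e. classes of) measurable functions `f : α → ℂ` such that
`∫ Φ(c |f|) dμ < ∞` for some `c > 0`. -/
def OrliczSpace (Φ : YoungFunction) (μ : Measure α) : Submodule ℂ (α →ₘ[μ] ℂ) where
  carrier := {f | ∃ c > 0, orliczModular Φ μ c f < ∞}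
  zero_mem' := by
    refine ⟨1, one_pos, ?_⟩
    have : orliczModular Φ μ 1 ((0 : α →ₘ[μ] ℂ) : α → ℂ) = 0 := by
      unfold orliczModular
      rw [← lintegral_zero (μ := μ)]
      refine lintegral_congr_ae ?_
      filter_upwards [AEEqFun.coeFn_zero (α := α) (β := ℂ) (μ := μ)] with x hx
      simp [hx, Φ.map_zero_toFun]
    rw [this]; exact ENNReal.zero_lt_top
  add_mem' := by
    rintro f g ⟨c, hc, hf⟩ ⟨d, hd, hg⟩
    refine ⟨min c d / 2, by positivity, ?_⟩
    refine (orliczModular_add_le (a := 1 / 2) (b := 1 / 2) (c := c) (d := d) (f := f) (g := g)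
      Φ μ f.aestronglyMeasurable hc.le hd.le (by norm_num) (by norm_num) (by norm_num)
      (by positivity) ?_).trans_lt (ENNReal.add_lt_top.2
        ⟨ENNReal.mul_lt_top ENNReal.ofReal_lt_top hf, ENNReal.mul_lt_top ENNReal.ofReal_lt_top hg⟩)
    filter_upwards [AEEqFun.coeFn_add f g] with x hx
    rw [hx, Pi.add_apply]
    have h1 : min c d * ‖f x‖ ≤ c * ‖f x‖ := by gcongr; exact min_le_left _ _
    have h2 : min c d * ‖g x‖ ≤ d * ‖g x‖ := by gcongr; exact min_le_right _ _
    have h3 : min c d * ‖f x + g x‖ ≤ min c d * (‖f x‖ + ‖g x‖) := by gcongr; exact norm_add_le _ _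
    linarith
  smul_mem' := by
    rintro z f ⟨c, hc, hf⟩
    refine ⟨c / (‖z‖ + 1), by positivity, (orliczModular_mono Φ μ (by positivity) ?_).trans_lt hf⟩
    filter_upwards [AEEqFun.coeFn_smul z f] with x hx
    rw [hx, Pi.smul_apply, norm_smul, div_mul_eq_mul_div, div_le_iff₀ (by positivity)]
    nlinarith [mul_nonneg hc.le (norm_nonneg (f x))]

namespace OrliczSpace

variable {Φ : YoungFunction} {μ : Measure α}

noncomputable instance instNorm : Norm (OrliczSpace Φ μ) :=
  ⟨fun f => luxemburgNorm Φ μ ((f : α →ₘ[μ] ℂ) : α → ℂ)⟩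

theorem norm_def (f : OrliczSpace Φ μ) : ‖f‖ = luxemburgNorm Φ μ ((f : α →ₘ[μ] ℂ) : α → ℂ) := rfl

/-- If the modular of `g / C` is dominated by that of `f` at every scale, then
`N_Φ(g) ≤ C N_Φ(f)`. -/
theorem norm_le_mul (f g : OrliczSpace Φ μ) {C : ℝ} (hC : 0 < C)
    (h : ∀ k : ℝ, 0 < k → orliczModular Φ μ (C * k)⁻¹ ((g : α →ₘ[μ] ℂ) : α → ℂ) ≤
      orliczModular Φ μ k⁻¹ ((f : α →ₘ[μ] ℂ) : α → ℂ)) : ‖g‖ ≤ C * ‖f‖ := by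
  rw [← div_le_iff₀' hC]
  refine le_of_forall_gt_imp_ge_of_dense fun k hk => ?_
  have hk0 : 0 < k := (luxemburgNorm_nonneg Φ μ _).trans_lt hk
  rw [div_le_iff₀' hC]
  exact luxemburgNorm_le Φ μ (by positivity) ((h k hk0).trans (orliczModular_le_one Φ μ f.2 hk))

theorem norm_smul_le' (c : ℂ) (hc : c ≠ 0) (f : OrliczSpace Φ μ) : ‖c • f‖ ≤ ‖c‖ * ‖f‖ := by
  have hc' : 0 < ‖c‖ := norm_pos_iff.2 hc
  refine norm_le_mul f (c • f) hc' fun k hk => orliczModular_mono Φ μ (by positivity) ?_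
  filter_upwards [AEEqFun.coeFn_smul c (f : α →ₘ[μ] ℂ)] with x hx
  rw [Submodule.coe_smul, hx, Pi.smul_apply, norm_smul]
  refine le_of_eq ?_
  field_simp

theorem norm_zero' : ‖(0 : OrliczSpace Φ μ)‖ = 0 := by
  refine le_antisymm (le_of_forall_gt_imp_ge_of_dense fun k hk => ?_) (luxemburgNorm_nonneg Φ μ _)
  refine luxemburgNorm_le Φ μ hk ?_
  have : orliczModular Φ μ k⁻¹ (((0 : OrliczSpace Φ μ) : α →ₘ[μ] ℂ) : α → ℂ) = 0 := by
    unfold orliczModular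
    rw [← lintegral_zero (μ := μ)]
    refine lintegral_congr_ae ?_
    filter_upwards [AEEqFun.coeFn_zero (α := α) (β := ℂ) (μ := μ)] with x hx
    simp [hx, Φ.map_zero_toFun]
  rw [this]; exact zero_le_one

theorem norm_add_le' (f g : OrliczSpace Φ μ) : ‖f + g‖ ≤ ‖f‖ + ‖g‖ := by
  refine le_of_forall_pos_le_add fun ε hε => ?_
  have hf0 : 0 ≤ ‖f‖ := luxemburgNorm_nonneg Φ μ _
  have hg0 : 0 ≤ ‖g‖ := luxemburgNorm_nonneg Φ μ _
  set p := ‖f‖ + ε / 2 with hp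
  set q := ‖g‖ + ε / 2 with hq
  have hp0 : 0 < p := by positivity
  have hq0 : 0 < q := by positivity
  have h1 : orliczModular Φ μ p⁻¹ ((f : α →ₘ[μ] ℂ) : α → ℂ) ≤ 1 :=
    orliczModular_le_one Φ μ f.2 (show ‖f‖ < p by linarith)
  have h2 : orliczModular Φ μ q⁻¹ ((g : α →ₘ[μ] ℂ) : α → ℂ) ≤ 1 :=
    orliczModular_le_one Φ μ g.2 (show ‖g‖ < q by linarith)
  have h3 : ‖f + g‖ ≤ p + q := by
    refine luxemburgNorm_le Φ μ (by positivity) ?_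
    have hab : p / (p + q) + q / (p + q) = 1 := by field_simp
    refine (orliczModular_add_le (a := p / (p + q)) (b := q / (p + q)) (c := p⁻¹) (d := q⁻¹)
      (f := f) (g := g) Φ μ (f : α →ₘ[μ] ℂ).aestronglyMeasurable (by positivity) (by positivity)
      (by positivity) (by positivity) hab (by positivity) ?_).trans ?_
    · filter_upwards [AEEqFun.coeFn_add (f : α →ₘ[μ] ℂ) (g : α →ₘ[μ] ℂ)] with x hx
      rw [Submodule.coe_add, hx, Pi.add_apply]
      have : p / (p + q) * (p⁻¹ * ‖(f : α →ₘ[μ] ℂ) x‖) + q / (p + q) * (q⁻¹ * ‖(g : α →ₘ[μ] ℂ) x‖)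
        = (p + q)⁻¹ * (‖(f : α →ₘ[μ] ℂ) x‖ + ‖(g : α →ₘ[μ] ℂ) x‖) := by field_simp
      rw [this]
      gcongr
      exact norm_add_le _ _
    · calc _ ≤ ENNReal.ofReal (p / (p + q)) * 1 + ENNReal.ofReal (q / (p + q)) * 1 := by gcongr
        _ = 1 := by
          rw [mul_one, mul_one, ← ENNReal.ofReal_add (by positivity) (by positivity), hab,
            ENNReal.ofReal_one]
  linarith

theorem core : NormedSpace.Core ℂ (OrliczSpace Φ μ) where
  norm_nonneg f := luxemburgNorm_nonneg Φ μ _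
  norm_smul c f := by
    rcases eq_or_ne c 0 with rfl | hc
    · rw [zero_smul, norm_zero', norm_zero, zero_mul]
    · refine le_antisymm (norm_smul_le' c hc f) ?_
      have h := norm_smul_le' c⁻¹ (inv_ne_zero hc) (c • f)
      rw [inv_smul_smul₀ hc, norm_inv, inv_mul_eq_div, le_div_iff₀' (norm_pos_iff.2 hc)] at h
      exact h
  norm_triangle := norm_add_le'
  norm_eq_zero_iff f := by
    refine ⟨fun h => ?_, fun h => h ▸ norm_zero'⟩
    have h0 := luxemburgNorm_eq_zero Φ μ (f : α →ₘ[μ] ℂ).aestronglyMeasurable f.2 h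
    exact Subtype.ext (AEEqFun.ext (h0.trans AEEqFun.coeFn_zero.symm))

/-- `L^Φ(μ)` is normed by the Luxemburg norm. -/
noncomputable instance instNormedAddCommGroup : NormedAddCommGroup (OrliczSpace Φ μ) :=
  NormedAddCommGroup.ofCore core

noncomputable instance instNormedSpace : NormedSpace ℂ (OrliczSpace Φ μ) :=
  NormedSpace.ofCore core

end OrliczSpace

end Orlicz

/-! ## Weighted translations -/

/-- A weight on `G`: a bounded continuous function `w : G → (0, ∞)`, under the standing assumption
that `w⁻¹` is bounded too.
(For a continuous function, being essentially bounded for a Haar measure is being bounded.) -/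
structure GroupWeight (G : Type*) [TopologicalSpace G] where
  toFun : G → ℝ
  continuous_toFun : Continuous toFun
  pos_toFun : ∀ x, 0 < toFun x
  bddAbove_toFun : BddAbove (range toFun)
  bddAbove_inv_toFun : BddAbove (range fun x => (toFun x)⁻¹)

instance GroupWeight.instCoeFun {G : Type*} [TopologicalSpace G] : CoeFun (GroupWeight G) (fun _ => G → ℝ) :=
  ⟨GroupWeight.toFun⟩

theorem GroupWeight.exists_bound {G : Type*} [TopologicalSpace G] (w : GroupWeight G) : ∃ C : ℝ, 0 < C ∧ ∀ x, w x ≤ C := by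
  obtain ⟨C, hC⟩ := w.bddAbove_toFun
  exact ⟨max C 1, by positivity, fun x => (hC ⟨x, rfl⟩).trans (le_max_left _ _)⟩

section WeightedTranslation

variable {G : Type*} [Group G] [TopologicalSpace G] [IsTopologicalGroup G]
  [SecondCountableTopology G] [MeasurableSpace G] [BorelSpace G]

/-- The class of the function `x ↦ w x * f (x * a⁻¹)`. -/
noncomputable def weightedTranslationAux (μ : Measure G) [μ.IsMulRightInvariant] (a : G)
    (w : GroupWeight G) (f : G →ₘ[μ] ℂ) : G →ₘ[μ] ℂ :=
  AEEqFun.mk (fun x => (w x : ℂ) * f (x * a⁻¹))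
    ((Complex.continuous_ofReal.comp w.continuous_toFun).aestronglyMeasurable.mul
      (f.aestronglyMeasurable.comp_measurePreserving (measurePreserving_mul_right μ a⁻¹)))

theorem coeFn_weightedTranslationAux (μ : Measure G) [μ.IsMulRightInvariant] (a : G)
    (w : GroupWeight G) (f : G →ₘ[μ] ℂ) :
    weightedTranslationAux μ a w f =ᵐ[μ] fun x => (w x : ℂ) * f (x * a⁻¹) :=
  AEEqFun.coeFn_mk _ _

theorem orliczModular_translate (Φ : YoungFunction) (μ : Measure G) [μ.IsMulRightInvariant]
    (a : G) (c : ℝ) (f : G → ℂ) :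
    orliczModular Φ μ c (fun x => f (x * a⁻¹)) = orliczModular Φ μ c f :=
  lintegral_mul_right_eq_self (fun x => ENNReal.ofReal (Φ (c * ‖f x‖))) a⁻¹

theorem orliczModular_weightedTranslationAux_le (Φ : YoungFunction) (μ : Measure G)
    [μ.IsMulRightInvariant] (a : G) (w : GroupWeight G) (f : G →ₘ[μ] ℂ) {C c : ℝ}
    (hC0 : 0 < C) (hC : ∀ x, w x ≤ C) (hc : 0 ≤ c) :
    orliczModular Φ μ (C⁻¹ * c) (weightedTranslationAux μ a w f) ≤ orliczModular Φ μ c f := by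
  rw [← orliczModular_translate Φ μ a c f]
  refine orliczModular_mono Φ μ (by positivity) ?_
  filter_upwards [coeFn_weightedTranslationAux μ a w f] with x hx
  rw [hx, norm_mul, Complex.norm_of_nonneg (w.pos_toFun x).le, mul_assoc, inv_mul_le_iff₀ hC0]
  have := mul_le_mul_of_nonneg_right (hC x) (mul_nonneg hc (norm_nonneg (f (x * a⁻¹))))
  linarith

/-- The weighted translation `T_{a,w} f = w · (f * δ_a)`, that is,
`(T_{a,w} f)(x) = w x * f (x * a⁻¹)`, as a bounded operator on `L^Φ(G)`. -/
noncomputable def weightedTranslation (Φ : YoungFunction) (μ : Measure G) [μ.IsMulRightInvariant]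
    (a : G) (w : GroupWeight G) : OrliczSpace Φ μ →L[ℂ] OrliczSpace Φ μ :=
  LinearMap.mkContinuousOfExistsBound
    { toFun := fun f => ⟨weightedTranslationAux μ a w f, by
        obtain ⟨C, hC0, hC⟩ := w.exists_bound
        obtain ⟨c, hc, hf⟩ := f.2
        exact ⟨C⁻¹ * c, by positivity,
          (orliczModular_weightedTranslationAux_le Φ μ a w f hC0 hC hc.le).trans_lt hf⟩⟩
      map_add' := fun f g => by
        refine Subtype.ext (AEEqFun.ext ?_)
        have hs := (measurePreserving_mul_right μ a⁻¹).quasiMeasurePreserving.ae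
          (AEEqFun.coeFn_add (f : G →ₘ[μ] ℂ) (g : G →ₘ[μ] ℂ))
        filter_upwards [hs, coeFn_weightedTranslationAux μ a w (f + g : OrliczSpace Φ μ),
          coeFn_weightedTranslationAux μ a w f, coeFn_weightedTranslationAux μ a w g,
          AEEqFun.coeFn_add (weightedTranslationAux μ a w f) (weightedTranslationAux μ a w g)]
          with x h0 h1 h2 h3 h4
        simp only [Submodule.coe_add] at h1 ⊢
        rw [h1, h4, Pi.add_apply, h2, h3, h0, Pi.add_apply, mul_add]
      map_smul' := fun z f => by
        refine Subtype.ext (AEEqFun.ext ?_)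
        have hs := (measurePreserving_mul_right μ a⁻¹).quasiMeasurePreserving.ae
          (AEEqFun.coeFn_smul z (f : G →ₘ[μ] ℂ))
        filter_upwards [hs, coeFn_weightedTranslationAux μ a w (z • f : OrliczSpace Φ μ),
          coeFn_weightedTranslationAux μ a w f,
          AEEqFun.coeFn_smul z (weightedTranslationAux μ a w f)] with x h0 h1 h2 h4
        simp only [Submodule.coe_smul, RingHom.id_apply] at h1 ⊢
        rw [h1, h4, Pi.smul_apply, h2, h0, Pi.smul_apply, smul_eq_mul, smul_eq_mul]
        ring }
    (by
      obtain ⟨C, hC0, hC⟩ := w.exists_bound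
      refine ⟨C, fun f => OrliczSpace.norm_le_mul f _ hC0 fun k hk => ?_⟩
      rw [mul_inv]
      exact orliczModular_weightedTranslationAux_le Φ μ a w f hC0 hC (by positivity))

theorem coeFn_weightedTranslation (Φ : YoungFunction) (μ : Measure G) [μ.IsMulRightInvariant]
    (a : G) (w : GroupWeight G) (f : OrliczSpace Φ μ) :
    ((weightedTranslation Φ μ a w f : G →ₘ[μ] ℂ) : G → ℂ) =ᵐ[μ]
      fun x => (w x : ℂ) * (f : G →ₘ[μ] ℂ) (x * a⁻¹) :=
  coeFn_weightedTranslationAux μ a w f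

/-- `a` is aperiodic: the closed subgroup generated by `a` is not compact. -/
def IsAperiodicElement (a : G) : Prop :=
  ¬ IsCompact ((Subgroup.zpowers a).topologicalClosure : Set G)

end WeightedTranslation

/-! ## Topological dynamics -/

section Dynamics

variable {X : Type*} [TopologicalSpace X]

/-- Topological transitivity: `T^n U` meets `V` for some `n ≥ 1`. -/
def IsTopologicallyTransitive (T : X → X) : Prop :=
  ∀ U V : Set X, IsOpen U → IsOpen V → U.Nonempty → V.Nonempty →
    ∃ n : ℕ, 1 ≤ n ∧ (T^[n] '' U ∩ V).Nonempty

/-- Topological mixing: `T^n U` meets `V` from some `n` onwards. -/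
def IsTopologicallyMixing (T : X → X) : Prop :=
  ∀ U V : Set X, IsOpen U → IsOpen V → U.Nonempty → V.Nonempty →
    ∃ N : ℕ, ∀ n : ℕ, N ≤ n → (T^[n] '' U ∩ V).Nonempty

/-- Chaos: topological transitivity together with a dense set of periodic points. -/
def IsChaotic (T : X → X) : Prop :=
  IsTopologicallyTransitive T ∧ Dense (Function.periodicPts T)

/-- Topological multiple recurrence: for every `L ≥ 1` and every nonempty open `U` there is
`n ≥ 1` with `U ∩ T^{-n} U ∩ ⋯ ∩ T^{-Ln} U ≠ ∅`. -/
def IsTopologicallyMultiplyRecurrent (T : X → X) : Prop :=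
  ∀ L : ℕ, 1 ≤ L → ∀ U : Set X, IsOpen U → U.Nonempty →
    ∃ n : ℕ, 1 ≤ n ∧ (⋂ l ∈ Finset.range (L + 1), T^[l * n] ⁻¹' U).Nonempty

end Dynamics

/-! In the chaotic case a periodic point in `U` already returns to `U` at every multiple of its
period. In the mixing case the operator `T` has an inverse `S`, again a weighted translation. Given
`f`, the goal is one vector `q` near `f` and one `n ≥ 1` with `T^{ln} q` and `S^{ln} q` small for `1
≤ l ≤ L`. Then `∑_{l ≤ L} S^{ln} q` is the required point: applying `T^{kn}` gives `q` plus small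
terms, for each `k ≤ L`. Mixing only provides, for each large `m`, separate vectors near `f` that
`T^m` or `S^m` makes small. The lattice structure merges them: cutting `f` down to be dominated by
all of them moves it little (`exists_truncation_finset`), and since `T` and `S` preserve pointwise
domination, the truncated `q` inherits every smallness estimate (`exists_small_orbit`). -/

namespace OrliczSpace

/-! ### Truncation with respect to the lattice norm. -/

section Lattice

variable {α : Type*} [MeasurableSpace α] {Φ : YoungFunction} {μ : Measure α}

/-- The Luxemburg norm is a lattice norm. -/
theorem norm_le_mul_of_ae_le (f g : OrliczSpace Φ μ) {C : ℝ} (hC : 0 < C)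
    (h : ∀ᵐ x ∂μ, ‖(f : α →ₘ[μ] ℂ) x‖ ≤ C * ‖(g : α →ₘ[μ] ℂ) x‖) : ‖f‖ ≤ C * ‖g‖ := by
  refine norm_le_mul g f hC fun k hk => orliczModular_mono Φ μ (by positivity) ?_
  filter_upwards [h] with x hx
  calc (C * k)⁻¹ * ‖(f : α →ₘ[μ] ℂ) x‖ ≤ (C * k)⁻¹ * (C * ‖(g : α →ₘ[μ] ℂ) x‖) := by gcongr
    _ = k⁻¹ * ‖(g : α →ₘ[μ] ℂ) x‖ := by field_simp

/-- Multiplication by the indicator function of a measurable set acts on `L^Φ(μ)`. -/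
theorem exists_indicator (f : OrliczSpace Φ μ) {E : Set α} (hE : MeasurableSet E) :
    ∃ g : OrliczSpace Φ μ, (g : α →ₘ[μ] ℂ) =ᵐ[μ] E.indicator (f : α →ₘ[μ] ℂ) := by
  obtain ⟨c, hc, hf⟩ := f.2
  have hm := (f : α →ₘ[μ] ℂ).aestronglyMeasurable.indicator hE
  refine ⟨⟨AEEqFun.mk _ hm, c, hc, (orliczModular_mono Φ μ hc.le ?_).trans_lt hf⟩,
    AEEqFun.coeFn_mk _ hm⟩
  filter_upwards [AEEqFun.coeFn_mk _ hm] with x hx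
  rw [hx]
  gcongr
  exact norm_indicator_le_norm_self _ _

/-- A function `p` dominated by `f` can be cut down to a function dominated by `2 |g|`, at a cost
controlled by the distance from `f` to `g`. -/
theorem exists_truncation (f g p : OrliczSpace Φ μ)
    (hp : ∀ᵐ x ∂μ, ‖(p : α →ₘ[μ] ℂ) x‖ ≤ ‖(f : α →ₘ[μ] ℂ) x‖) :
    ∃ q : OrliczSpace Φ μ, (∀ᵐ x ∂μ, ‖(q : α →ₘ[μ] ℂ) x‖ ≤ ‖(p : α →ₘ[μ] ℂ) x‖) ∧
      (∀ᵐ x ∂μ, ‖(q : α →ₘ[μ] ℂ) x‖ ≤ 2 * ‖(g : α →ₘ[μ] ℂ) x‖) ∧ ‖p - q‖ ≤ 2 * ‖f - g‖ := by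
  classical
  have hE : MeasurableSet {x | ‖(p : α →ₘ[μ] ℂ) x‖ ≤ 2 * ‖(g : α →ₘ[μ] ℂ) x‖} :=
    measurableSet_le (p : α →ₘ[μ] ℂ).measurable.norm
      ((g : α →ₘ[μ] ℂ).measurable.norm.const_mul 2)
  obtain ⟨q, hq⟩ := exists_indicator p hE
  refine ⟨q, ?_, ?_, norm_le_mul_of_ae_le _ _ two_pos ?_⟩
  · filter_upwards [hq] with x hx
    rw [hx]
    exact norm_indicator_le_norm_self _ _
  · filter_upwards [hq] with x hx
    rw [hx, indicator_apply]
    split_ifs with h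
    · exact h
    · simp
  · filter_upwards [hq, hp, AEEqFun.coeFn_sub (p : α →ₘ[μ] ℂ) (q : α →ₘ[μ] ℂ),
      AEEqFun.coeFn_sub (f : α →ₘ[μ] ℂ) (g : α →ₘ[μ] ℂ)] with x hx hpx h1 h2
    rw [Submodule.coe_sub, Submodule.coe_sub, h1, h2, Pi.sub_apply, Pi.sub_apply, hx,
      indicator_apply]
    split_ifs with h
    · simp
    · rw [mem_ofPred_eq, not_le] at h
      rw [sub_zero]
      -- Where `p` is cut away, `2|g| < |p| ≤ |f|`, so `|p| ≤ 2|p| - 2|g| ≤ 2(|f| - |g|) ≤ 2|f -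
      -- g|`.
      linarith [norm_sub_norm_le ((f : α →ₘ[μ] ℂ) x) ((g : α →ₘ[μ] ℂ) x)]

/-- A function can be cut down so as to be dominated by finitely many functions near it. -/
theorem exists_truncation_finset {ι : Type*} (s : Finset ι) (f : OrliczSpace Φ μ)
    (g : ι → OrliczSpace Φ μ) :
    ∃ q : OrliczSpace Φ μ, (∀ᵐ x ∂μ, ‖(q : α →ₘ[μ] ℂ) x‖ ≤ ‖(f : α →ₘ[μ] ℂ) x‖) ∧
      (∀ i ∈ s, ∀ᵐ x ∂μ, ‖(q : α →ₘ[μ] ℂ) x‖ ≤ 2 * ‖(g i : α →ₘ[μ] ℂ) x‖) ∧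
      ‖f - q‖ ≤ ∑ i ∈ s, 2 * ‖f - g i‖ := by
  classical
  induction s using Finset.induction_on with
  | empty => exact ⟨f, .of_forall fun _ => le_rfl, by simp, by simp⟩
  | insert i s hi ih =>
    obtain ⟨p, hpf, hpg, hp⟩ := ih
    obtain ⟨q, hqp, hqg, hq⟩ := exists_truncation f (g i) p hpf
    refine ⟨q, ?_, ?_, ?_⟩
    · filter_upwards [hqp, hpf] with x h1 h2 using h1.trans h2
    · intro j hj
      rcases Finset.mem_insert.1 hj with rfl | hj
      · exact hqg
      · filter_upwards [hqp, hpg j hj] with x h1 h2 using h1.trans h2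
    · rw [Finset.sum_insert hi, ← sub_add_sub_cancel' p q f]
      exact (norm_add_le _ _).trans (add_le_add hq hp)

/-! ### Operators preserving domination, and recurrence from mixing. -/

/-- A map of `L^Φ(μ)` respects domination when it preserves inequalities `|f| ≤ C |g|` a.e. -/
def RespectsDomination (T : OrliczSpace Φ μ → OrliczSpace Φ μ) : Prop :=
  ∀ (C : ℝ) (f g : OrliczSpace Φ μ),
    (∀ᵐ x ∂μ, ‖(f : α →ₘ[μ] ℂ) x‖ ≤ C * ‖(g : α →ₘ[μ] ℂ) x‖) →
      ∀ᵐ x ∂μ, ‖(T f : α →ₘ[μ] ℂ) x‖ ≤ C * ‖(T g : α →ₘ[μ] ℂ) x‖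

theorem RespectsDomination.iterate {T : OrliczSpace Φ μ → OrliczSpace Φ μ}
    (hT : RespectsDomination T) (n : ℕ) : RespectsDomination T^[n] := by
  induction n with
  | zero => exact fun _ _ _ h => h
  | succ n ih =>
    intro C f g h
    rw [Function.iterate_succ_apply, Function.iterate_succ_apply]
    exact ih C _ _ (hT C f g h)

/-- The form in which domination is used: if `T g` is small, so is `T f` for every `f` dominated by
a multiple of `g`. -/
theorem RespectsDomination.norm_le {T : OrliczSpace Φ μ → OrliczSpace Φ μ}
    (hT : RespectsDomination T) {C : ℝ} (hC : 0 < C) {f g : OrliczSpace Φ μ}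
    (h : ∀ᵐ x ∂μ, ‖(f : α →ₘ[μ] ℂ) x‖ ≤ C * ‖(g : α →ₘ[μ] ℂ) x‖) : ‖T f‖ ≤ C * ‖T g‖ :=
  norm_le_mul_of_ae_le _ _ hC (hT C f g h)

/-- If a mixing invertible operator and its inverse respect domination, then every vector has
arbitrarily small perturbations `q` for which all `T^{±ln} q`, `1 ≤ l ≤ L`, are small, for a
suitable `n ≥ 1`. -/
theorem exists_small_orbit {T S : OrliczSpace Φ μ → OrliczSpace Φ μ}
    (hST : Function.LeftInverse S T) (hT : RespectsDomination T) (hS : RespectsDomination S)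
    (hmix : IsTopologicallyMixing T) (f : OrliczSpace Φ μ) (L : ℕ) {δ : ℝ} (hδ : 0 < δ) :
    ∃ n : ℕ, 1 ≤ n ∧ ∃ q : OrliczSpace Φ μ, ‖f - q‖ ≤ L * (4 * δ) ∧
      ∀ l ∈ Finset.Icc 1 L, ‖T^[l * n] q‖ ≤ 2 * δ ∧ ‖S^[l * n] q‖ ≤ 2 * δ := by
  have hf := Metric.nonempty_ball (x := f).2 hδ
  have h0 := Metric.nonempty_ball (x := (0 : OrliczSpace Φ μ)).2 hδ
  obtain ⟨N₁, hN₁⟩ := hmix _ _ Metric.isOpen_ball Metric.isOpen_ball hf h0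
  obtain ⟨N₂, hN₂⟩ := hmix _ _ Metric.isOpen_ball Metric.isOpen_ball h0 hf
  -- The bound on `m` sits inside the existential so that `choose` yields a function of `m` alone;
  -- the value `0` for small `m` plays no role.
  have key₁ : ∀ m, ∃ g, N₁ ≤ m → ‖f - g‖ ≤ δ ∧ ‖T^[m] g‖ ≤ δ := by
    intro m
    by_cases hm : N₁ ≤ m
    · obtain ⟨_, ⟨g, hg, rfl⟩, hg'⟩ := hN₁ m hm
      rw [Metric.mem_ball, dist_comm, dist_eq_norm] at hg
      rw [mem_ball_zero_iff] at hg'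
      exact ⟨g, fun _ => ⟨hg.le, hg'.le⟩⟩
    · exact ⟨0, fun h => absurd h hm⟩
  have key₂ : ∀ m, ∃ g, N₂ ≤ m → ‖f - g‖ ≤ δ ∧ ‖S^[m] g‖ ≤ δ := by
    intro m
    by_cases hm : N₂ ≤ m
    · obtain ⟨_, ⟨g, hg, rfl⟩, hg'⟩ := hN₂ m hm
      rw [Metric.mem_ball, dist_comm, dist_eq_norm] at hg'
      rw [mem_ball_zero_iff] at hg
      -- Mixing from the ball at `0` to the ball at `f`, read backwards: `T^[m] g` is near `f`, and
      -- `S^[m]` returns it to the small vector `g`.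
      exact ⟨T^[m] g, fun _ => ⟨hg'.le, by rw [hST.iterate m g]; exact hg.le⟩⟩
    · exact ⟨0, fun h => absurd h hm⟩
  choose g hg using key₁
  choose h hh using key₂
  set n := max (max N₁ N₂) 1 with hn
  have hle : ∀ l ∈ Finset.Icc 1 L, N₁ ≤ l * n ∧ N₂ ≤ l * n := by
    intro l hl
    have h1 : n ≤ l * n := Nat.le_mul_of_pos_left n (Finset.mem_Icc.1 hl).1
    omega
  -- The two copies of `Icc 1 L` index the forward and backward vectors. Each of the `2L`
  -- truncations costs at most `2 * δ`, whence `L * (4 * δ)`.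
  obtain ⟨q, hqp, hqh, hq⟩ := exists_truncation_finset
    ((Finset.Icc 1 L).disjSum (Finset.Icc 1 L)) f (Sum.elim (fun l => g (l * n)) fun l => h (l * n))
  refine ⟨n, le_max_right _ _, q, hq.trans ?_, fun l hl => ⟨?_, ?_⟩⟩
  · rw [Finset.sum_disjSum, ← Finset.sum_add_distrib]
    refine (Finset.sum_le_card_nsmul _ _ (4 * δ) fun l hl => ?_).trans (by simp)
    have h1 := (hg (l * n) (hle l hl).1).1
    have h2 := (hh (l * n) (hle l hl).2).1
    simp only [Sum.elim_inl, Sum.elim_inr]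
    linarith
  · have h1 := (hT.iterate (l * n)).norm_le two_pos (hqh (.inl l) (Finset.inl_mem_disjSum.2 hl))
    have h2 := (hg (l * n) (hle l hl).1).2
    simp only [Sum.elim_inl] at h1
    linarith
  · have h1 := (hS.iterate (l * n)).norm_le two_pos (hqh (.inr l) (Finset.inr_mem_disjSum.2 hl))
    have h2 := (hh (l * n) (hle l hl).2).2
    simp only [Sum.elim_inr] at h1
    linarith

/-- A mixing invertible operator on `L^Φ(μ)` is topologically multiply recurrent if it and its
inverse respect domination. -/
theorem isTopologicallyMultiplyRecurrent_of_mixing {T S : OrliczSpace Φ μ →L[ℂ] OrliczSpace Φ μ}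
    (hST : Function.LeftInverse S T) (hTS : Function.RightInverse S T)
    (hT : RespectsDomination T) (hS : RespectsDomination S) (hmix : IsTopologicallyMixing T) :
    IsTopologicallyMultiplyRecurrent T := by
  rintro L - U hU ⟨f, hf⟩
  obtain ⟨ε, hε, hball⟩ := Metric.isOpen_iff.1 hU f hf
  -- The final error is at most `4Lδ` from truncation plus `2Lδ` from the off-diagonal terms, and
  -- `6Lδ < 8(L + 1)δ = ε`.
  obtain ⟨n, hn, q, hq, hsmall⟩ := exists_small_orbit hST hT hS hmix f L
    (δ := ε / (8 * (L + 1))) (by positivity)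
  set δ := ε / (8 * (L + 1)) with hδ
  have hδ0 : 0 < δ := by positivity
  have hδε : δ * (8 * (L + 1)) = ε := by rw [hδ]; field_simp
  refine ⟨n, hn, ∑ l ∈ Finset.range (L + 1), S^[l * n] q, mem_iInter₂.2 fun k hk => hball ?_⟩
  have hterm : ∀ l ∈ (Finset.range (L + 1)).erase k, ‖T^[k * n] (S^[l * n] q)‖ ≤ 2 * δ := by
    intro l hl
    rw [Finset.mem_erase, Finset.mem_range] at hl
    rw [Finset.mem_range] at hk
    rcases lt_or_gt_of_ne hl.1 with h | h
    -- For `l < k` the inverse powers cancel and leave `T^[(k - l) * n] q`; for `l > k` what is left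
    -- is `S^[(l - k) * n] q`. Both exponents are covered by `hsmall`.
    · rw [show k * n = (k - l) * n + l * n by rw [← add_mul]; congr 1; omega,
        Function.iterate_add_apply, hTS.iterate (l * n) q]
      exact (hsmall _ (Finset.mem_Icc.2 (by omega))).1
    · rw [show l * n = k * n + (l - k) * n by rw [← add_mul]; congr 1; omega,
        Function.iterate_add_apply, hTS.iterate (k * n) (S^[(l - k) * n] q)]
      exact (hsmall _ (Finset.mem_Icc.2 (by omega))).2
  have hsplit : T^[k * n] (∑ l ∈ Finset.range (L + 1), S^[l * n] q) =
      ∑ l ∈ Finset.range (L + 1), T^[k * n] (S^[l * n] q) := by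
    rw [← FunLike.coe_pow_eq_iterate, map_sum]
  -- The term `l = k` is exactly `q`; it is paired with `f`, leaving the small terms as a separate
  -- sum.
  rw [Metric.mem_ball, dist_eq_norm, hsplit, ← Finset.add_sum_erase _ _ hk, hTS.iterate (k * n) q,
    add_sub_right_comm]
  have hsum : ‖∑ l ∈ (Finset.range (L + 1)).erase k, T^[k * n] (S^[l * n] q)‖ ≤ L * (2 * δ) := by
    refine (norm_sum_le_of_le _ hterm).trans_eq ?_
    rw [Finset.sum_const, Finset.card_erase_of_mem hk, Finset.card_range, nsmul_eq_mul]
    simp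
  calc _ ≤ ‖q - f‖ + L * (2 * δ) := (norm_add_le _ _).trans (add_le_add le_rfl hsum)
    _ ≤ L * (4 * δ) + L * (2 * δ) := by rw [norm_sub_rev]; gcongr
    _ < ε := by
      have : 0 ≤ (L : ℝ) * δ := by positivity
      linarith

end Lattice

end OrliczSpace

/-- A point of `U` fixed by `T^[n]` is fixed by every `T^[l * n]`, so a single `n` serves all `l`.
-/
theorem IsTopologicallyMultiplyRecurrent.of_dense_periodicPts {X : Type*} [TopologicalSpace X]
    {T : X → X} (h : Dense (Function.periodicPts T)) : IsTopologicallyMultiplyRecurrent T := by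
  rintro L - U hU hne
  obtain ⟨x, hxU, n, hn, hx⟩ := h.inter_open_nonempty U hU hne
  refine ⟨n, hn, x, mem_iInter₂.2 fun l _ => ?_⟩
  rw [mem_preimage, (hx.const_mul l).eq]
  exact hxU

/-! ### Weighted translations are invertible and preserve domination. -/

section WeightedTranslation

variable {G : Type*} [Group G] [TopologicalSpace G] [IsTopologicalGroup G]

/-- The weight of the inverse of a weighted translation. -/
noncomputable def GroupWeight.inverse (w : GroupWeight G) (a : G) : GroupWeight G where
  -- Solving `w x * f (x * a⁻¹) = g x` for `f` gives `f x = (w (x * a))⁻¹ * g (x * a)`.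
  toFun x := (w (x * a))⁻¹
  continuous_toFun := (w.continuous_toFun.comp (continuous_mul_const a)).inv₀
    fun x => (w.pos_toFun (x * a)).ne'
  pos_toFun x := inv_pos.2 (w.pos_toFun (x * a))
  bddAbove_toFun := w.bddAbove_inv_toFun.mono (by rintro _ ⟨x, rfl⟩; exact ⟨x * a, rfl⟩)
  bddAbove_inv_toFun := w.bddAbove_toFun.mono
    (by rintro _ ⟨x, rfl⟩; exact ⟨x * a, (inv_inv _).symm⟩)

variable [SecondCountableTopology G] [MeasurableSpace G] [BorelSpace G]
  (Φ : YoungFunction) (μ : Measure G) [μ.IsMulRightInvariant] (a : G) (w : GroupWeight G)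

theorem weightedTranslation_inverse_leftInverse :
    Function.LeftInverse (weightedTranslation Φ μ a⁻¹ (w.inverse a))
      (weightedTranslation Φ μ a w) := by
  intro f
  refine Subtype.ext (AEEqFun.ext ?_)
  filter_upwards [coeFn_weightedTranslation Φ μ a⁻¹ (w.inverse a) (weightedTranslation Φ μ a w f),
    -- The a.e. formula for the inner operator is needed at the translated point, so it is pulled
    -- back along the measure-preserving right translation.
    (measurePreserving_mul_right μ a⁻¹⁻¹).quasiMeasurePreserving.ae
      (coeFn_weightedTranslation Φ μ a w f)] with x h1 h2
  have hw : (w (x * a) : ℂ) ≠ 0 := Complex.ofReal_ne_zero.2 (w.pos_toFun _).ne'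
  rw [h1, h2]
  simp only [GroupWeight.inverse, inv_inv, mul_inv_cancel_right, Complex.ofReal_inv]
  exact inv_mul_cancel_left₀ hw _

theorem weightedTranslation_inverse_rightInverse :
    Function.RightInverse (weightedTranslation Φ μ a⁻¹ (w.inverse a))
      (weightedTranslation Φ μ a w) := by
  intro f
  refine Subtype.ext (AEEqFun.ext ?_)
  filter_upwards [coeFn_weightedTranslation Φ μ a w
      (weightedTranslation Φ μ a⁻¹ (w.inverse a) f),
    (measurePreserving_mul_right μ a⁻¹).quasiMeasurePreserving.ae
      (coeFn_weightedTranslation Φ μ a⁻¹ (w.inverse a) f)] with x h1 h2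
  have hw : (w x : ℂ) ≠ 0 := Complex.ofReal_ne_zero.2 (w.pos_toFun _).ne'
  rw [h1, h2]
  simp only [GroupWeight.inverse, inv_inv, inv_mul_cancel_right, Complex.ofReal_inv]
  exact mul_inv_cancel_left₀ hw _

/-- Right translation preserves null sets, and multiplying by `w x` scales both sides of the
inequality by the same factor. -/
theorem weightedTranslation_respectsDomination :
    OrliczSpace.RespectsDomination (weightedTranslation Φ μ a w) := by
  intro C f g h
  filter_upwards [coeFn_weightedTranslation Φ μ a w f, coeFn_weightedTranslation Φ μ a w g,
    (measurePreserving_mul_right μ a⁻¹).quasiMeasurePreserving.ae h] with x h1 h2 h3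
  rw [h1, h2, norm_mul, norm_mul, mul_left_comm]
  gcongr

end WeightedTranslation

theorem corollary3p3 {G : Type*} [Group G] [TopologicalSpace G] [IsTopologicalGroup G]
    [T2Space G] [LocallyCompactSpace G] [SecondCountableTopology G]
    [MeasurableSpace G] [BorelSpace G]
    (μ : Measure G) [μ.IsMulRightInvariant] [IsFiniteMeasureOnCompacts μ] (hμ : μ ≠ 0)
    (Φ : YoungFunction) (hΦ : Φ.IsDelta2Regular G)
    (a : G) (ha : IsAperiodicElement a) (w : GroupWeight G)
    (h : IsChaotic (weightedTranslation Φ μ a w) ∨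
      IsTopologicallyMixing (weightedTranslation Φ μ a w)) :
    IsTopologicallyMultiplyRecurrent (weightedTranslation Φ μ a w) := by
  rcases h with h | h
  · exact .of_dense_periodicPts h.2
  · exact OrliczSpace.isTopologicallyMultiplyRecurrent_of_mixing
      (weightedTranslation_inverse_leftInverse Φ μ a w)
      (weightedTranslation_inverse_rightInverse Φ μ a w)
      (weightedTranslation_respectsDomination Φ μ a w)
      (weightedTranslation_respectsDomination Φ μ a⁻¹ (w.inverse a)) h
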